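/- Let $a,b,c,d,e,f,t\in\mathbb{C}$ satisfy $cd+af=0$ and $tcd+be=0$. Let $W=V=\mathbb{C}^2$ with orthonormal basis $|0\rangle,|1\rangle$, and let $L(u)\in\mathrm{End}(W\otimes V)$ be given, in the ordered basis $|0\rangle|0\rangle,|0\rangle|1\rangle,|1\rangle|0\rangle,|1\rangle|1\rangle$, by $$L(u)=\begin{pmatrix} au+b&0&0&0\\ 0&atu+b&(1-t)cu&0\\ 0&(1-t)d&eu+f&0\\ 0&0&0&eu+tf\end{pmatrix}.$$ For $M\ge 0$ let $T_a(u)=L_{aM}(u)\cdots L_{a1}(u)$ on $W_a\otimes V_1\otimes\cdots\otimes V_M$, where $L_{aj}(u)$ is $L(u)$ acting on $W_a\otimes V_j$, and put $$B(u)={}_a\langle 0|T_a(u)|1\rangle_a,\qquad C(u)={}_a\langle 1|T_a(u)|0\rangle_a,$$ which are operators on $V_1\otimes\cdots\otimes V_M$. Write $|\Omega\rangle=|0^M\rangle$, $|1\cdots M\rangle=|1^M\rangle$, and $\langle\Omega|$, $\langle 1\cdots M|$ for their duals. For $\sigma^+=|0\rangle\langle 1|$, $\sigma^-=|1\rangle\langle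 0|$ and $1\le x_1<\cdots<x_N\le M$ put $$|x\rangle=\prod_j\sigma^-_{x_j}|\Omega\rangle,\quad \langle x|=\langle\Omega|\prod_j\sigma^+_{x_j},\quad |\overline{x}\rangle=\prod_j\sigma^+_{x_j}|1\cdots M\rangle,\quad \langle\overline{x}|=\langle 1\cdots M|\prod_j\sigma^-_{x_j}.$$ (In $|\overline{x}\rangle$ and $\langle\overline{x}|$ the $x_j$ are the positions of the holes, also written $\overline{x_j}$.) Let $u_1,\dots,u_N\in\mathbb{C}$ be pairwise distinct. Then each of the following four identities holds whenever no denominator on its right-hand side vanishes. (In (3) and (4) the stated conditions and $tcd+be=0$ already force $t\ne0$ when $N\ge1$.) (1) If $au_j+b\neq0$ and $eu_j+f\neq0$ for all $j$, and $tu_j\neq u_k$ for all $j<k$, then $$\langle x|B(u_N)\cdots B(u_1)|\Omega\rangle=G_x(u_1,\dots,u_N):=\prod_{j=1}^N\frac{(1-t)cu_j(au_j+b)^M}{eu_j+f}\prod_{1\le j<k\le N}\frac{tu_j-u_k}{u_j-u_k}\sum_{\sigma\in S_N}\prod_{\substack{1\le j<k\le N\\ \sigma(j)>\sigma(k)}}\frac{u_{\sigma(k)}-tu_{\sigma(j)}}{tu_{\sigma(k)}-u_{\sigma(j)}}\prod_{j=1}^N\left(\frac{eu_{\sigma(j)}+f}{au_{\sigma(j)}+b}\right)^{x_j}.$$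 (2) If $au_j+b\neq0$ and $eu_j+f\neq0$ for all $j$, and $u_j\neq tu_k$ for all $j<k$, then $$\langle\Omega|C(u_1)\cdots C(u_N)|x\rangle=\overline{G}_x(u_1,\dots,u_N):=\prod_{j=1}^N\frac{(1-t)d(eu_j+f)^M}{au_j+b}\prod_{1\le j<k\le N}\frac{u_j-tu_k}{u_j-u_k}\sum_{\sigma\in S_N}\prod_{\substack{1\le j<k\le N\\ \sigma(j)>\sigma(k)}}\frac{tu_{\sigma(k)}-u_{\sigma(j)}}{u_{\sigma(k)}-tu_{\sigma(j)}}\prod_{j=1}^N\left(\frac{au_{\sigma(j)}+b}{eu_{\sigma(j)}+f}\right)^{x_j}.$$ (3) If $atu_j+b\neq0$ and $eu_j+tf\neq0$ for all $j$, and $u_j\neq tu_k$ for all $j<k$, then $$\langle 1\cdots M|B(u_1)\cdots B(u_N)|\overline{x}\rangle=H_{\overline{x}}(u_1,\dots,u_N):=\prod_{j=1}^N\frac{(1-t)cu_j(atu_j+b)^M}{eu_j+tf}\prod_{1\le j<k\le N}\frac{u_j-tu_k}{t(u_j-u_k)}\sum_{\sigma\in S_N}\prod_{\substack{1\le j<k\le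 N\\ \sigma(j)>\sigma(k)}}\frac{tu_{\sigma(k)}-u_{\sigma(j)}}{u_{\sigma(k)}-tu_{\sigma(j)}}\prod_{j=1}^N\left(\frac{eu_{\sigma(j)}+tf}{atu_{\sigma(j)}+b}\right)^{\overline{x_j}}.$$ (4) If $atu_j+b\neq0$ and $eu_j+tf\neq0$ for all $j$, and $tu_j\neq u_k$ for all $j<k$, then $$\langle\overline{x}|C(u_N)\cdots C(u_1)|1\cdots M\rangle=\overline{H}_{\overline{x}}(u_1,\dots,u_N):=\prod_{j=1}^N\frac{(1-t)d(eu_j+tf)^M}{atu_j+b}\prod_{1\le j<k\le N}\frac{tu_j-u_k}{t(u_j-u_k)}\sum_{\sigma\in S_N}\prod_{\substack{1\le j<k\le N\\ \sigma(j)>\sigma(k)}}\frac{u_{\sigma(k)}-tu_{\sigma(j)}}{tu_{\sigma(k)}-u_{\sigma(j)}}\prod_{j=1}^N\left(\frac{atu_{\sigma(j)}+b}{eu_{\sigma(j)}+tf}\right)^{\overline{x_j}}.$$ -/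

import Mathlib

namespace SixVertex

open Matrix

/-- The parameters `a, b, c, d, e, f` of the `L`-operator and the quantum group parameter `t`. -/
structure Params where
  a : ℂ
  b : ℂ
  c : ℂ
  d : ℂ
  e : ℂ
  f : ℂ
  t : ℂ

/-- The constraints `cd + af = 0` and `tcd + be = 0`. -/
def Params.Constraints (p : Params) : Prop :=
  p.c * p.d + p.a * p.f = 0 ∧ p.t * p.c * p.d + p.b * p.e = 0

/-- The `L`-operator `L(u)` on `W ⊗ V`, with `W = V = ℂ²`, in the ordered basis
`|0⟩|0⟩, |0⟩|1⟩, |1⟩|0⟩, |1⟩|1⟩` (auxiliary space `W` first, quantum space `V` second).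
`finProdFinEquiv` sends `(α, β)` to `2 * α + β`, so `L(u) (γ, δ) (α, β) = ⟨γ|⟨δ| L(u) |α⟩|β⟩`. -/
noncomputable def lOp (p : Params) (u : ℂ) : Matrix (Fin 2 × Fin 2) (Fin 2 × Fin 2) ℂ :=
  (!![p.a * u + p.b, 0, 0, 0;
      0, p.a * p.t * u + p.b, (1 - p.t) * p.c * u, 0;
      0, (1 - p.t) * p.d, p.e * u + p.f, 0;
      0, 0, 0, p.e * u + p.t * p.f] : Matrix (Fin 4) (Fin 4) ℂ).submatrix
    finProdFinEquiv finProdFinEquiv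

/-- The standard basis of `V₁ ⊗ ⋯ ⊗ V_M` is indexed by the functions `s : Fin M → Fin 2`:
`s` stands for `|s 0⟩₁ ⊗ ⋯ ⊗ |s (M - 1)⟩_M`; site `j + 1` of the chain is `j : Fin M`. -/
abbrev Conf (M : ℕ) : Type := Fin M → Fin 2

/-- The operator `L_{aj}(u)` on `W_a ⊗ V₁ ⊗ ⋯ ⊗ V_M`, acting as `L(u)` on `W_a ⊗ V_j` and as the
identity on the other factors. -/
noncomputable def lOpAt (p : Params) (M : ℕ) (u : ℂ) (j : Fin M) :
    Matrix (Fin 2 × Conf M) (Fin 2 × Conf M) ℂ :=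
  Matrix.of fun r s =>
    if ∀ k, k ≠ j → r.2 k = s.2 k then lOp p u (r.1, r.2 j) (s.1, s.2 j) else 0

/-- The monodromy matrix `T_a(u) = L_{aM}(u) ⋯ L_{a1}(u)`. -/
noncomputable def monodromy (p : Params) (M : ℕ) (u : ℂ) :
    Matrix (Fin 2 × Conf M) (Fin 2 × Conf M) ℂ :=
  (List.ofFn fun j : Fin M => lOpAt p M u j).reverse.prod

/-- `B(u) = ⟨0|_a T_a(u) |1⟩_a`. -/
noncomputable def opB (p : Params) (M : ℕ) (u : ℂ) : Matrix (Conf M) (Conf M) ℂ :=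
  Matrix.of fun r s => monodromy p M u (0, r) (1, s)

/-- `C(u) = ⟨1|_a T_a(u) |0⟩_a`. -/
noncomputable def opC (p : Params) (M : ℕ) (u : ℂ) : Matrix (Conf M) (Conf M) ℂ :=
  Matrix.of fun r s => monodromy p M u (1, r) (0, s)

/-- `σ⁺ = |0⟩⟨1|`. -/
def sigmaPlus : Matrix (Fin 2) (Fin 2) ℂ := !![0, 1; 0, 0]

/-- `σ⁻ = |1⟩⟨0|`. -/
def sigmaMinus : Matrix (Fin 2) (Fin 2) ℂ := !![0, 0; 1, 0]

/-- The operator on `V₁ ⊗ ⋯ ⊗ V_M` acting as `A` on `V_j` and as the identity elsewhere. -/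
def siteOp {M : ℕ} (A : Matrix (Fin 2) (Fin 2) ℂ) (j : Fin M) : Matrix (Conf M) (Conf M) ℂ :=
  Matrix.of fun r s => if ∀ k, k ≠ j → r k = s k then A (r j) (s j) else 0

/-- `A_{x_1} A_{x_2} ⋯ A_{x_N}`. -/
def siteProd {M N : ℕ} (A : Matrix (Fin 2) (Fin 2) ℂ) (x : Fin N → Fin M) :
    Matrix (Conf M) (Conf M) ℂ :=
  (List.ofFn fun j : Fin N => siteOp A (x j)).prod

/-- The coordinate vector of `|Ω⟩ = |0^M⟩`, and also of its dual `⟨Ω|`. -/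
def vacuum (M : ℕ) : Conf M → ℂ := Pi.single (fun _ => 0) 1

/-- The coordinate vector of `|1⋯M⟩ = |1^M⟩`, and also of its dual `⟨1⋯M|`. -/
def occupied (M : ℕ) : Conf M → ℂ := Pi.single (fun _ => 1) 1

/-- `|x_1 ⋯ x_N⟩ = ∏ σ⁻_{x_j} |0^M⟩`. -/
def particleKet {M N : ℕ} (x : Fin N → Fin M) : Conf M → ℂ :=
  siteProd sigmaMinus x *ᵥ vacuum M

/-- `⟨x_1 ⋯ x_N| = ⟨0^M| ∏ σ⁺_{x_j}`. -/
def particleBra {M N : ℕ} (x : Fin N → Fin M) : Conf M → ℂ :=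
  vacuum M ᵥ* siteProd sigmaPlus x

/-- `|x̄_1 ⋯ x̄_N⟩ = ∏ σ⁺_{x̄_j} |1^M⟩`. -/
def holeKet {M N : ℕ} (x : Fin N → Fin M) : Conf M → ℂ :=
  siteProd sigmaPlus x *ᵥ occupied M

/-- `⟨x̄_1 ⋯ x̄_N| = ⟨1^M| ∏ σ⁻_{x̄_j}`. -/
def holeBra {M N : ℕ} (x : Fin N → Fin M) : Conf M → ℂ :=
  occupied M ᵥ* siteProd sigmaMinus x

/-- `|ψ({u})⟩ = B(u_N) ⋯ B(u_1) |Ω⟩`. -/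
noncomputable def psiKet (p : Params) (M : ℕ) {N : ℕ} (u : Fin N → ℂ) : Conf M → ℂ :=
  (List.ofFn fun j => opB p M (u j)).reverse.prod *ᵥ vacuum M

/-- `⟨ψ({u})| = ⟨Ω| C(u_1) ⋯ C(u_N)`. -/
noncomputable def psiBra (p : Params) (M : ℕ) {N : ℕ} (u : Fin N → ℂ) : Conf M → ℂ :=
  vacuum M ᵥ* (List.ofFn fun j => opC p M (u j)).prod

/-- `⟨φ({u})| = ⟨1⋯M| B(u_1) ⋯ B(u_N)`. -/
noncomputable def phiBra (p : Params) (M : ℕ) {N : ℕ} (u : Fin N → ℂ) : Conf M → ℂ :=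
  occupied M ᵥ* (List.ofFn fun j => opB p M (u j)).prod

/-- `|φ({u})⟩ = C(u_N) ⋯ C(u_1) |1⋯M⟩`. -/
noncomputable def phiKet (p : Params) (M : ℕ) {N : ℕ} (u : Fin N → ℂ) : Conf M → ℂ :=
  (List.ofFn fun j => opC p M (u j)).reverse.prod *ᵥ occupied M

/-- The product of `g j k` over all pairs `j < k`. -/
noncomputable def pairProd {N : ℕ} (g : Fin N → Fin N → ℂ) : ℂ :=
  ∏ q : Fin N × Fin N with q.1 < q.2, g q.1 q.2

/-- The product of `g j k` over the inversions `j < k`, `σ(j) > σ(k)` of `σ`. -/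
noncomputable def invProd {N : ℕ} (σ : Equiv.Perm (Fin N)) (g : Fin N → Fin N → ℂ) : ℂ :=
  ∏ q : Fin N × Fin N with q.1 < q.2 ∧ σ q.2 < σ q.1, g q.1 q.2

/-- `G_x(u_1, …, u_N)`; the position `x_j ∈ {1, …, M}` is `(x j : ℕ) + 1`. -/
noncomputable def polyG (p : Params) (M : ℕ) {N : ℕ} (x : Fin N → Fin M) (u : Fin N → ℂ) : ℂ :=
  (∏ j, (1 - p.t) * p.c * u j * (p.a * u j + p.b) ^ M / (p.e * u j + p.f)) *
    pairProd (fun j k => (p.t * u j - u k) / (u j - u k)) *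
    ∑ σ : Equiv.Perm (Fin N),
      invProd σ (fun j k => (u (σ k) - p.t * u (σ j)) / (p.t * u (σ k) - u (σ j))) *
        ∏ j, ((p.e * u (σ j) + p.f) / (p.a * u (σ j) + p.b)) ^ ((x j : ℕ) + 1)

/-- `Ḡ_x(u_1, …, u_N)`. -/
noncomputable def polyGBar (p : Params) (M : ℕ) {N : ℕ} (x : Fin N → Fin M) (u : Fin N → ℂ) : ℂ :=
  (∏ j, (1 - p.t) * p.d * (p.e * u j + p.f) ^ M / (p.a * u j + p.b)) *
    pairProd (fun j k => (u j - p.t * u k) / (u j - u k)) *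
    ∑ σ : Equiv.Perm (Fin N),
      invProd σ (fun j k => (p.t * u (σ k) - u (σ j)) / (u (σ k) - p.t * u (σ j))) *
        ∏ j, ((p.a * u (σ j) + p.b) / (p.e * u (σ j) + p.f)) ^ ((x j : ℕ) + 1)

/-- `H_x̄(u_1, …, u_N)`. -/
noncomputable def polyH (p : Params) (M : ℕ) {N : ℕ} (x : Fin N → Fin M) (u : Fin N → ℂ) : ℂ :=
  (∏ j, (1 - p.t) * p.c * u j * (p.a * p.t * u j + p.b) ^ M / (p.e * u j + p.t * p.f)) *
    pairProd (fun j k => (u j - p.t * u k) / (p.t * (u j - u k))) *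
    ∑ σ : Equiv.Perm (Fin N),
      invProd σ (fun j k => (p.t * u (σ k) - u (σ j)) / (u (σ k) - p.t * u (σ j))) *
        ∏ j, ((p.e * u (σ j) + p.t * p.f) / (p.a * p.t * u (σ j) + p.b)) ^ ((x j : ℕ) + 1)

/-- `H̄_x̄(u_1, …, u_N)`. -/
noncomputable def polyHBar (p : Params) (M : ℕ) {N : ℕ} (x : Fin N → Fin M) (u : Fin N → ℂ) : ℂ :=
  (∏ j, (1 - p.t) * p.d * (p.e * u j + p.t * p.f) ^ M / (p.a * p.t * u j + p.b)) *
    pairProd (fun j k => (p.t * u j - u k) / (p.t * (u j - u k))) *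
    ∑ σ : Equiv.Perm (Fin N),
      invProd σ (fun j k => (u (σ k) - p.t * u (σ j)) / (p.t * u (σ k) - u (σ j))) *
        ∏ j, ((p.a * p.t * u (σ j) + p.b) / (p.e * u (σ j) + p.t * p.f)) ^ ((x j : ℕ) + 1)

end SixVertex

/-!
All four amplitudes are coordinates of a Bethe vector `X(u_N) ⋯ X(u_1)|o⋯o⟩`, where `(X, Y, o)` is
`(B, D, 0)`, `(Cᵀ, Aᵀ, 0)`, `(Bᵀ, Dᵀ, 1)` or `(C, A, 1)`. In each case the pair `(X, Y)` of a chain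
of `M + 1` sites is obtained from that of `M` sites by the same triangular block matrices in the
letter of the last site (`chainOps`, `chainOps_eq`); only the weights differ. So one argument for
general weights serves all four.

The constraints on the parameters give the scalar identities `SiteWeights.Exchange` (they are needed
for `vac_vac` and `exc_exc'`). With these, commutativity of the `X(u)`, commutativity of the `Y(u)`
and the relation `Y(u)X(v) = direct X(v)Y(u) + cross X(u)Y(v)` pass together from `M` to `M + 1`
sites (`chain_exchange`); no other entries of the monodromy matrix are needed.
The exchange relations give the action of `Y` on a Bethe vector (`chainY_mulVec_betheVec`), hence
the part of a Bethe vector with an excited last site: it is a sum, over the parameter `u_i` spent on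
that site, of Bethe vectors of the shorter chain in the other parameters (`betheVec_excited`).
Iterating over the sites gives the coordinate at `x` as a symmetric sum over permutations
(`betheVec_markedConf`),
`∑_σ ∏_{j<k} direct(u_{σ(k)}, u_{σ(j)}) ∏_j create · vacY^{x_j - 1} · vacX^{M - x_j}` at `u_{σ(j)}`,
with `x_j ∈ {1, …, M}`. Factoring out the term of the identity permutation leaves the product over
the inversions of `σ` (`pairProd_mul_invProd`, `betheVec_eq`), which is the claimed formula.
-/

namespace SixVertex

open Matrix

variable {ι : Type*}

/-! ### Exchange relations of a chain with general weights -/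

/-- A configuration of `M + 1` sites is a configuration of the first `M` sites together with the
last letter: the left summand has the vacuum letter `o` there, the right summand the other one. -/
def splitLast (o : Fin 2) (M : ℕ) : Conf M ⊕ Conf M ≃ Conf (M + 1) where
  toFun := Sum.elim (fun s => Fin.snoc (α := fun _ => Fin 2) s o)
    (fun s => Fin.snoc (α := fun _ => Fin 2) s (1 - o))
  invFun s := if s (Fin.last M) = o then Sum.inl (Fin.init s) else Sum.inr (Fin.init s)
  left_inv := by
    have h : 1 - o ≠ o := by revert o; decide
    rintro (s | s) <;> simp [h]
  right_inv s := by
    have h : ∀ x o : Fin 2, x ≠ o → 1 - o = x := by decide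
    by_cases hs : s (Fin.last M) = o
    · simp only [hs, if_true, Sum.elim_inl]
      rw [← hs]; exact Fin.snoc_init_self s
    · simp only [hs, if_false, Sum.elim_inr, h _ _ hs]
      exact Fin.snoc_init_self s

/-- Boltzmann weights of a single site, for a family of spectral parameters indexed by `ι`. The
prefixes `vac` and `exc` refer to the vacuum and the other letter on that site, the suffixes to the
operator `X` or `Y`; `create` and `annihilate` weigh the change of the letter away from and back to
the vacuum. The last two fields are the coefficients of the exchange relation
`Y i * X j = direct i j • (X j * Y i) + cross i j • (X i * Y j)`. -/
structure SiteWeights (ι : Type*) where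
  vacX : ι → ℂ
  excX : ι → ℂ
  create : ι → ℂ
  vacY : ι → ℂ
  excY : ι → ℂ
  annihilate : ι → ℂ
  direct : ι → ι → ℂ
  cross : ι → ι → ℂ

/-- The creation operator `X` and the diagonal operator `Y` of a chain of `M` sites. Adding a last
site acts by the matrices `X = (vacX·X', 0; create·Y', excX·X')` and
`Y = (vacY·Y', annihilate·X'; 0, excY·Y')`, written in the basis (vacuum, excited) of that site. -/
noncomputable def chainOps (w : SiteWeights ι) (o : Fin 2) :
    (M : ℕ) → ι → Matrix (Conf M) (Conf M) ℂ × Matrix (Conf M) (Conf M) ℂ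
  | 0, _ => (0, 1)
  | M + 1, i =>
    (reindexAlgEquiv ℂ ℂ (splitLast o M)
      (fromBlocks (w.vacX i • (chainOps w o M i).1) 0
        (w.create i • (chainOps w o M i).2) (w.excX i • (chainOps w o M i).1)),
     reindexAlgEquiv ℂ ℂ (splitLast o M)
      (fromBlocks (w.vacY i • (chainOps w o M i).2) (w.annihilate i • (chainOps w o M i).1)
        0 (w.excY i • (chainOps w o M i).2)))

/-- The creation operator `X` of the chain. -/
noncomputable def chainX (w : SiteWeights ι) (o : Fin 2) (M : ℕ) (i : ι) :
    Matrix (Conf M) (Conf M) ℂ := (chainOps w o M i).1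

/-- The diagonal operator `Y` of the chain. -/
noncomputable def chainY (w : SiteWeights ι) (o : Fin 2) (M : ℕ) (i : ι) :
    Matrix (Conf M) (Conf M) ℂ := (chainOps w o M i).2

/-- The scalar identities between the weights that make the exchange relations of `X` and `Y`
pass from a chain to the chain with one more site (`commX` and `commY` for the two commutativity
relations, the next five for the blocks of the mixed one), and `cross_cross`, by which the unwanted
terms in the action of `Y` on a Bethe vector combine. -/
structure SiteWeights.Exchange (w : SiteWeights ι) : Prop where
  commX : ∀ i j, i ≠ j → w.excX i * w.create j + w.create i * w.vacX j * w.cross i j =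
    w.create j * w.vacX i * w.direct j i
  commY : ∀ i j, i ≠ j → w.vacY i * w.annihilate j * w.cross i j + w.annihilate i * w.excY j =
    w.vacY j * w.annihilate i * w.direct j i
  annihilate_excX : ∀ i j, i ≠ j → w.annihilate i * w.excX j =
    w.direct i j * w.vacX j * w.annihilate i + w.cross i j * w.vacX i * w.annihilate j
  excY_create : ∀ i j, i ≠ j → w.excY i * w.create j =
    w.direct i j * w.create j * w.vacY i + w.cross i j * w.create i * w.vacY j
  vac_vac : ∀ i j, i ≠ j → w.cross i j * (w.vacY i * w.vacX j - w.vacX i * w.vacY j) +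
    w.annihilate i * w.create j = 0
  exc_exc : ∀ i j, i ≠ j → w.direct i j * (w.create j * w.annihilate i * w.cross j i +
    w.cross i j * w.create i * w.annihilate j) = 0
  exc_exc' : ∀ i j, i ≠ j → w.cross i j * w.excY i * w.excX j =
    w.direct i j * w.create j * w.annihilate i * w.direct j i +
      w.cross i j * w.excX i * w.excY j + w.cross i j ^ 2 * w.create i * w.annihilate j
  cross_cross : ∀ i j, i ≠ j → ∀ k, j ≠ k → i ≠ k →
    w.direct i j * w.cross i k + w.cross i j * w.cross j k = w.cross i k * w.direct k j

theorem chainX_succ (w : SiteWeights ι) (o : Fin 2) (M : ℕ) (i : ι) :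
    chainX w o (M + 1) i = reindexAlgEquiv ℂ ℂ (splitLast o M)
      (fromBlocks (w.vacX i • chainX w o M i) 0
        (w.create i • chainY w o M i) (w.excX i • chainX w o M i)) := rfl

theorem chainY_succ (w : SiteWeights ι) (o : Fin 2) (M : ℕ) (i : ι) :
    chainY w o (M + 1) i = reindexAlgEquiv ℂ ℂ (splitLast o M)
      (fromBlocks (w.vacY i • chainY w o M i) (w.annihilate i • chainX w o M i)
        0 (w.excY i • chainY w o M i)) := rfl

/-- The exchange relations. The three of them carry each other through the induction on the number
of sites. -/
theorem chain_exchange {w : SiteWeights ι} (hw : w.Exchange) (o : Fin 2) (M : ℕ) :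
    ∀ i j, i ≠ j →
      chainX w o M i * chainX w o M j = chainX w o M j * chainX w o M i ∧
      chainY w o M i * chainY w o M j = chainY w o M j * chainY w o M i ∧
      chainY w o M i * chainX w o M j =
        w.direct i j • (chainX w o M j * chainY w o M i) +
          w.cross i j • (chainX w o M i * chainY w o M j) := by
  induction M with
  | zero => intro i j _; simp [chainX, chainY, chainOps]
  | succ M ih =>
    intro i j hij
    obtain ⟨hX, hY, hYX⟩ := ih i j hij
    obtain ⟨-, -, hYX'⟩ := ih j i hij.symm
    simp only [chainX_succ, chainY_succ, ← map_mul, ← map_smul, ← map_add,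
      EmbeddingLike.apply_eq_iff_eq, fromBlocks_multiply, fromBlocks_smul, fromBlocks_add,
      fromBlocks_inj, smul_mul_smul_comm,
      Matrix.mul_zero, Matrix.zero_mul, add_zero, zero_add, true_and,
      hX, hY, hYX, hYX']
    -- The goals are the three nonzero blocks of `XX`, those of `YY`, and the four blocks of `YX`.
    refine ⟨⟨?_, ?_, ?_⟩, ⟨?_, ?_, ?_⟩, ?_, ?_, ?_, ?_⟩
    · module
    · match_scalars
      · linear_combination -hw.commX j i hij.symm
      · linear_combination hw.commX i j hij
    · module
    · module
    · match_scalars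
      · linear_combination -hw.commY j i hij.symm
      · linear_combination hw.commY i j hij
    · module
    · match_scalars
      · ring
      · linear_combination hw.vac_vac i j hij
    · match_scalars
      linear_combination hw.annihilate_excX i j hij
    · match_scalars
      linear_combination hw.excY_create i j hij
    · match_scalars
      · linear_combination -hw.exc_exc i j hij
      · linear_combination hw.exc_exc' i j hij

/-! ### Bethe vectors -/

/-- The basis vector `|o⋯o⟩`. -/
def uniformVec (o : Fin 2) (M : ℕ) : Conf M → ℂ := Pi.single (fun _ => o) 1

/-- The Bethe vector `X(u_N) ⋯ X(u_1) |o⋯o⟩`. -/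
noncomputable def betheVec (w : SiteWeights ι) (o : Fin 2) (M : ℕ) {N : ℕ} (u : Fin N → ι) :
    Conf M → ℂ :=
  (List.ofFn fun j => chainX w o M (u j)).reverse.prod *ᵥ uniformVec o M

theorem betheVec_zero (w : SiteWeights ι) (o : Fin 2) (M : ℕ) (u : Fin 0 → ι) :
    betheVec w o M u = uniformVec o M := by
  simp [betheVec]

theorem betheVec_succ (w : SiteWeights ι) (o : Fin 2) (M : ℕ) {N : ℕ} (u : Fin (N + 1) → ι) :
    betheVec w o M u =
      chainX w o M (u (Fin.last N)) *ᵥ betheVec w o M (fun j => u j.castSucc) := by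
  simp only [betheVec, List.ofFn_succ_last, List.reverse_append, List.reverse_cons,
    List.reverse_nil, List.nil_append, List.singleton_append, List.prod_cons, mulVec_mulVec]

theorem reindexAlgEquiv_fromBlocks_mulVec_inl (o : Fin 2) (M : ℕ)
    (P Q R S : Matrix (Conf M) (Conf M) ℂ) (ψ : Conf (M + 1) → ℂ) (s : Conf M) :
    (reindexAlgEquiv ℂ ℂ (splitLast o M) (fromBlocks P Q R S) *ᵥ ψ) (splitLast o M (.inl s)) =
      (P *ᵥ fun r => ψ (splitLast o M (.inl r))) s +
        (Q *ᵥ fun r => ψ (splitLast o M (.inr r))) s := by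
  simp [coe_reindexAlgEquiv, submatrix_mulVec_equiv, fromBlocks_mulVec, Function.comp_def]

theorem reindexAlgEquiv_fromBlocks_mulVec_inr (o : Fin 2) (M : ℕ)
    (P Q R S : Matrix (Conf M) (Conf M) ℂ) (ψ : Conf (M + 1) → ℂ) (s : Conf M) :
    (reindexAlgEquiv ℂ ℂ (splitLast o M) (fromBlocks P Q R S) *ᵥ ψ) (splitLast o M (.inr s)) =
      (R *ᵥ fun r => ψ (splitLast o M (.inl r))) s +
        (S *ᵥ fun r => ψ (splitLast o M (.inr r))) s := by
  simp [coe_reindexAlgEquiv, submatrix_mulVec_equiv, fromBlocks_mulVec, Function.comp_def]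

theorem uniformVec_splitLast_inl (o : Fin 2) (M : ℕ) (s : Conf M) :
    uniformVec o (M + 1) (splitLast o M (.inl s)) =
      uniformVec o M s := by
  have h : (fun _ : Fin (M + 1) => o) = splitLast o M (.inl fun _ => o) := by
    ext k; refine Fin.lastCases ?_ (fun k => ?_) k <;> simp [splitLast]
  simp only [uniformVec, Pi.single_apply, h, EmbeddingLike.apply_eq_iff_eq, Sum.inl.injEq]

theorem uniformVec_splitLast_inr (o : Fin 2) (M : ℕ) (s : Conf M) :
    uniformVec o (M + 1) (splitLast o M (.inr s)) = 0 := by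
  have h : (fun _ : Fin (M + 1) => o) = splitLast o M (.inl fun _ => o) := by
    ext k; refine Fin.lastCases ?_ (fun k => ?_) k <;> simp [splitLast]
  simp [uniformVec, h]

theorem chainY_mulVec_vacuum (w : SiteWeights ι) (o : Fin 2) (M : ℕ) (i : ι) :
    chainY w o M i *ᵥ uniformVec o M =
      w.vacY i ^ M • uniformVec o M := by
  induction M with
  | zero => simp [chainY, chainOps]
  | succ M ih =>
    ext s
    obtain ⟨s | s, rfl⟩ := (splitLast o M).surjective s
    · rw [chainY_succ, reindexAlgEquiv_fromBlocks_mulVec_inl]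
      simp only [uniformVec_splitLast_inl, uniformVec_splitLast_inr, smul_mulVec, ih, Pi.smul_apply,
        smul_eq_mul]
      rw [show (fun _ : Conf M => (0 : ℂ)) = 0 from rfl, mulVec_zero, Pi.zero_apply]
      ring
    · rw [chainY_succ, reindexAlgEquiv_fromBlocks_mulVec_inr]
      simp only [uniformVec_splitLast_inr, Pi.smul_apply, zero_mulVec]
      rw [show (fun _ : Conf M => (0 : ℂ)) = 0 from rfl, mulVec_zero]
      simp

theorem castSucc_succAbove_last {n : ℕ} (i : Fin (n + 1)) :
    i.castSucc.succAbove (Fin.last n) = Fin.last (n + 1) := by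
  rw [Fin.succAbove_of_le_castSucc _ _ (Fin.castSucc_le_castSucc_iff.2 (Fin.le_last i)),
    Fin.succ_last]

/-- The action of the diagonal operator on a Bethe vector: the wanted term, and one unwanted term
for each factor `X(u_i)` that is traded for `X(v)`. -/
theorem chainY_mulVec_betheVec {w : SiteWeights ι} (hw : w.Exchange) (o : Fin 2) (M : ℕ) {N : ℕ}
    (u : Fin (N + 1) → ι) (hu : Function.Injective u) (v : ι) (hv : ∀ j, v ≠ u j) :
    chainY w o M v *ᵥ betheVec w o M u =
      (w.vacY v ^ M * ∏ j, w.direct v (u j)) • betheVec w o M u +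
        ∑ i, (w.cross v (u i) * w.vacY (u i) ^ M * ∏ j, w.direct (u i) (u (i.succAbove j))) •
          (chainX w o M v *ᵥ betheVec w o M fun j => u (i.succAbove j)) := by
  induction N generalizing v with
  | zero =>
    rw [betheVec_succ, mulVec_mulVec, (chain_exchange hw o M v _ (hv _)).2.2]
    simp [betheVec_zero, add_mulVec, smul_mulVec, ← mulVec_mulVec, chainY_mulVec_vacuum,
      mulVec_smul, smul_smul, mul_comm]
  | succ N ih =>
    have hne : ∀ j : Fin (N + 1), u (Fin.last _) ≠ u j.castSucc := fun j h =>
      (Fin.castSucc_lt_last j).ne' (hu h)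
    have ih' := ih (fun j => u j.castSucc) (fun a b h => Fin.castSucc_injective _ (hu h))
    rw [betheVec_succ, mulVec_mulVec, (chain_exchange hw o M v _ (hv _)).2.2, add_mulVec,
      smul_mulVec, smul_mulVec, ← mulVec_mulVec, ← mulVec_mulVec, ih' v (fun j => hv _),
      ih' _ hne, Fin.sum_univ_castSucc (n := N + 1), Fin.prod_univ_castSucc (n := N + 1)]
    simp only [Fin.prod_univ_castSucc (n := N), Fin.succAbove_last, castSucc_succAbove_last,
      Fin.castSucc_succAbove_castSucc,
      betheVec_succ w o M (fun j => u ((Fin.castSucc _).succAbove j)), mulVec_add, mulVec_smul,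
      mulVec_sum, smul_add, Finset.smul_sum, smul_smul]
    have key : ∀ i : Fin (N + 1), chainX w o M (u (Fin.last _)) *ᵥ (chainX w o M v *ᵥ
        betheVec w o M fun j => u (i.succAbove j).castSucc) = chainX w o M v *ᵥ
        (chainX w o M (u (Fin.last _)) *ᵥ betheVec w o M fun j => u (i.succAbove j).castSucc) := by
      intro i
      rw [mulVec_mulVec, mulVec_mulVec, (chain_exchange hw o M v _ (hv _)).1]
    simp only [key]
    -- `cross_cross` merges the two contributions in which `X(u_i)` has been traded for `X(v)`.
    have hsum : ∀ i : Fin (N + 1), w.cross v (u i.castSucc) * w.vacY (u i.castSucc) ^ M *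
        ((∏ j, w.direct (u i.castSucc) (u (i.succAbove j).castSucc)) *
          w.direct (u i.castSucc) (u (Fin.last _))) =
        w.direct v (u (Fin.last _)) * (w.cross v (u i.castSucc) * w.vacY (u i.castSucc) ^ M *
          ∏ j, w.direct (u i.castSucc) (u (i.succAbove j).castSucc)) +
        w.cross v (u (Fin.last _)) * (w.cross (u (Fin.last _)) (u i.castSucc) *
          w.vacY (u i.castSucc) ^ M *
            ∏ j, w.direct (u i.castSucc) (u (i.succAbove j).castSucc)) := fun i => by
      linear_combination -(w.vacY (u i.castSucc) ^ M *
        ∏ j, w.direct (u i.castSucc) (u (i.succAbove j).castSucc)) *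
          hw.cross_cross v _ (hv (Fin.last _)) _ (hne i) (hv _)
    simp only [hsum, add_smul, Finset.sum_add_distrib]
    module

/-- The component of a Bethe vector with the vacuum letter at the last site. -/
theorem betheVec_vacant (w : SiteWeights ι) (o : Fin 2) (M : ℕ) {N : ℕ}
    (u : Fin N → ι) (s : Conf M) :
    betheVec w o (M + 1) u (splitLast o M (.inl s)) =
      (∏ j, w.vacX (u j)) * betheVec w o M u s := by
  induction N generalizing s with
  | zero => simp [betheVec_zero, uniformVec_splitLast_inl]
  | succ N ih =>
    rw [betheVec_succ, chainX_succ, reindexAlgEquiv_fromBlocks_mulVec_inl]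
    simp only [ih]
    rw [show (fun r => (∏ j : Fin N, w.vacX (u j.castSucc)) * betheVec w o M
      (fun j => u j.castSucc) r) = (∏ j : Fin N, w.vacX (u j.castSucc)) • betheVec w o M
      (fun j => u j.castSucc) from rfl]
    rw [betheVec_succ w o M, zero_mulVec, smul_mulVec, mulVec_smul, Fin.prod_univ_castSucc]
    simp only [Pi.smul_apply, Pi.zero_apply, smul_eq_mul]
    ring

/-- The component of a Bethe vector with an excitation at the last site, as a combination of Bethe
vectors of the shorter chain. The factor that creates the excitation brings in `Y` of the shorter
chain, and the unwanted terms of `chainY_mulVec_betheVec` recombine by `commX` into a sum over the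
removed parameter. -/
theorem betheVec_excited {w : SiteWeights ι} (hw : w.Exchange) (o : Fin 2) (M : ℕ) {N : ℕ}
    (u : Fin (N + 1) → ι) (hu : Function.Injective u) (s : Conf M) :
    betheVec w o (M + 1) u (splitLast o M (.inr s)) =
      ∑ i, (w.create (u i) * w.vacY (u i) ^ M *
        ∏ j, w.vacX (u (i.succAbove j)) * w.direct (u i) (u (i.succAbove j))) *
          betheVec w o M (fun j => u (i.succAbove j)) s := by
  induction N generalizing s with
  | zero =>
    rw [betheVec_succ, chainX_succ, reindexAlgEquiv_fromBlocks_mulVec_inr]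
    simp only [betheVec_zero, uniformVec_splitLast_inl, uniformVec_splitLast_inr]
    rw [show (fun _ : Conf M => (0 : ℂ)) = 0 from rfl, mulVec_zero, smul_mulVec]
    rw [show (fun r => uniformVec o M r) = uniformVec o M from rfl, chainY_mulVec_vacuum]
    simp [mul_assoc]
  | succ N ih =>
    have hne : ∀ j : Fin (N + 1), u (Fin.last _) ≠ u j.castSucc := fun j h =>
      (Fin.castSucc_lt_last j).ne' (hu h)
    have hu' : Function.Injective fun j : Fin (N + 1) => u j.castSucc :=
      fun a b h => Fin.castSucc_injective _ (hu h)
    have hvac : (fun r => betheVec w o (M + 1) (fun j => u j.castSucc) (splitLast o M (.inl r))) =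
        (∏ j : Fin (N + 1), w.vacX (u j.castSucc)) • betheVec w o M fun j => u j.castSucc :=
      funext fun r => betheVec_vacant w o M _ r
    have hexc : (fun r => betheVec w o (M + 1) (fun j => u j.castSucc) (splitLast o M (.inr r))) =
        ∑ i : Fin (N + 1), (w.create (u i.castSucc) * w.vacY (u i.castSucc) ^ M *
          ∏ j, w.vacX (u (i.succAbove j).castSucc) *
            w.direct (u i.castSucc) (u (i.succAbove j).castSucc)) •
              betheVec w o M (fun j => u (i.succAbove j).castSucc) := by
      ext r
      simp [ih _ hu', Finset.sum_apply]
    rw [betheVec_succ, chainX_succ, reindexAlgEquiv_fromBlocks_mulVec_inr, hvac, hexc,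
      smul_mulVec, smul_mulVec, mulVec_smul,
      chainY_mulVec_betheVec hw o M _ hu' _ hne, Fin.sum_univ_castSucc (n := N + 1)]
    simp only [Fin.prod_univ_castSucc (n := N), Fin.succAbove_last, castSucc_succAbove_last,
      Fin.castSucc_succAbove_castSucc,
      betheVec_succ w o M (fun j => u ((Fin.castSucc _).succAbove j)), mulVec_smul, mulVec_sum,
      smul_add, Finset.smul_sum, smul_smul, Pi.add_apply,
      Finset.sum_apply, Pi.smul_apply, smul_eq_mul, mul_add,
      Finset.mul_sum, Finset.prod_mul_distrib]
    rw [add_assoc, ← Finset.sum_add_distrib, add_comm]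
    congr 1
    · refine Finset.sum_congr rfl fun i _ => ?_
      have hprod := Fin.prod_univ_succAbove (fun j : Fin (N + 1) => w.vacX (u j.castSucc)) i
      rw [Fin.prod_univ_castSucc] at hprod
      rw [hprod]
      linear_combination w.vacY (u i.castSucc) ^ M *
        (∏ j, w.vacX (u (i.succAbove j).castSucc)) *
        (∏ j, w.direct (u i.castSucc) (u (i.succAbove j).castSucc)) *
        (chainX w o M (u (Fin.last (N + 1))) *ᵥ
          betheVec w o M fun j => u (i.succAbove j).castSucc) s * hw.commX _ _ (hne i)
    · ring

/-! ### Coordinates of Bethe vectors -/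

/-- The permutation that sends the last index to `i` and acts on the others as `τ`. -/
def permOfLast {N : ℕ} (i : Fin (N + 1)) (τ : Equiv.Perm (Fin N)) : Equiv.Perm (Fin (N + 1)) :=
  (finSuccEquiv' (Fin.last N)).trans (τ.optionCongr.trans (finSuccEquiv' i).symm)

theorem permOfLast_last {N : ℕ} (i : Fin (N + 1)) (τ : Equiv.Perm (Fin N)) :
    permOfLast i τ (Fin.last N) = i := by
  simp [permOfLast]

theorem permOfLast_castSucc {N : ℕ} (i : Fin (N + 1)) (τ : Equiv.Perm (Fin N)) (j : Fin N) :
    permOfLast i τ j.castSucc = i.succAbove (τ j) := by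
  have h : finSuccEquiv' (Fin.last N) j.castSucc = some j := by
    rw [← Fin.succAbove_last]
    exact finSuccEquiv'_succAbove _ _
  simp [permOfLast, h]

theorem sum_perm_succ {N : ℕ} (F : Equiv.Perm (Fin (N + 1)) → ℂ) :
    ∑ σ, F σ = ∑ i, ∑ τ, F (permOfLast i τ) := by
  rw [← Fintype.sum_prod_type' (fun i τ => F (permOfLast i τ))]
  refine (Function.Bijective.sum_comp (Function.Injective.bijective_of_nat_card_le
    (f := fun q : Fin (N + 1) × Equiv.Perm (Fin N) => permOfLast q.1 q.2) ?_ ?_) F).symm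
  · rintro ⟨i, τ⟩ ⟨i', τ'⟩ h
    have hi : i = i' := by simpa [permOfLast_last] using DFunLike.congr_fun h (Fin.last N)
    subst hi
    refine Prod.ext rfl (Equiv.ext fun j => ?_)
    simpa [permOfLast_castSucc] using DFunLike.congr_fun h j.castSucc
  · simp [Nat.card_eq_fintype_card, Fintype.card_perm, Nat.factorial_succ]

theorem pairProd_succ {N : ℕ} (g : Fin (N + 1) → Fin (N + 1) → ℂ) :
    pairProd g = pairProd (fun j k : Fin N => g j.castSucc k.castSucc) *
      ∏ j : Fin N, g j.castSucc (Fin.last N) := by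
  have hlast : ∀ k : Fin N, ¬ Fin.last N < k.castSucc := fun k => (Fin.castSucc_lt_last k).not_gt
  simp [pairProd, Finset.prod_filter, Fintype.prod_prod_type, Fin.prod_univ_castSucc,
    Finset.prod_mul_distrib, Fin.castSucc_lt_last, hlast]

/-- The configuration with the letter `1 - o` at the sites `x_j` and the letter `o` elsewhere. -/
def markedConf {M N : ℕ} (o : Fin 2) (x : Fin N → Fin M) : Conf M :=
  fun k => if ∃ j, x j = k then 1 - o else o

theorem markedConf_castSucc {M N : ℕ} (o : Fin 2) (x : Fin N → Fin M) :
    markedConf o (fun j => (x j).castSucc) = splitLast o M (.inl (markedConf o x)) := by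
  ext k
  refine Fin.lastCases ?_ (fun k => ?_) k <;> simp [splitLast, markedConf, Fin.castSucc_ne_last]

theorem markedConf_last {M N : ℕ} (o : Fin 2) (x : Fin (N + 1) → Fin (M + 1)) (y : Fin N → Fin M)
    (hx : ∀ j, x j.castSucc = (y j).castSucc) (hlast : x (Fin.last N) = Fin.last M) :
    markedConf o x = splitLast o M (.inr (markedConf o y)) := by
  ext k; refine Fin.lastCases ?_ (fun k => ?_) k
  · simp only [splitLast, markedConf, Equiv.coe_fn_mk, Sum.elim_inr, Fin.snoc_last]
    rw [if_pos ⟨_, hlast⟩]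
  · simp [splitLast, markedConf, Fin.exists_fin_succ', hx, hlast, (Fin.castSucc_ne_last k).symm]

/-- The coordinates of a Bethe vector, as a sum over the assignments of the spectral parameters to
the excited sites. Removing the last site either leaves all parameters in place or, when that site
is excited, removes the parameter assigned to it. -/
theorem betheVec_markedConf {w : SiteWeights ι} (hw : w.Exchange) (o : Fin 2) (M : ℕ) {N : ℕ}
    (u : Fin N → ι) (hu : Function.Injective u) (x : Fin N → Fin M) (hx : StrictMono x) :
    betheVec w o M u (markedConf o x) = ∑ σ : Equiv.Perm (Fin N),
      pairProd (fun j k => w.direct (u (σ k)) (u (σ j))) *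
        ∏ j, w.create (u (σ j)) * w.vacY (u (σ j)) ^ (x j : ℕ) *
          w.vacX (u (σ j)) ^ ((x j).rev : ℕ) := by
  induction M generalizing N with
  | zero =>
    cases N with
    | zero =>
      rw [betheVec_zero, uniformVec, Subsingleton.elim (markedConf o x) (fun _ => o)]
      simp [pairProd]
    | succ N => exact (x 0).elim0
  | succ M ih =>
    by_cases h : ∃ j, x j = Fin.last M
    · obtain ⟨j, hj⟩ := h
      cases N with
      | zero => exact j.elim0
      | succ N =>
        have hlast : x (Fin.last N) = Fin.last M :=
          le_antisymm (Fin.le_last _) (hj ▸ hx.monotone (Fin.le_last j))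
        have hne : ∀ k : Fin N, x k.castSucc ≠ Fin.last M := fun k =>
          (hlast ▸ hx (Fin.castSucc_lt_last k)).ne
        choose y hy using fun k => Fin.exists_castSucc_eq.2 (hne k)
        have hymono : StrictMono y := fun a b hab => by
          have := hx (Fin.castSucc_lt_castSucc_iff.2 hab)
          rwa [← hy, ← hy, Fin.castSucc_lt_castSucc_iff] at this
        rw [markedConf_last o x y (fun j => (hy j).symm) hlast, betheVec_excited hw o M u hu,
          sum_perm_succ]
        refine Finset.sum_congr rfl fun i _ => ?_
        rw [ih (fun j => u (i.succAbove j)) (fun a b hab => Fin.succAbove_right_injective (hu hab))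
          y hymono, Finset.mul_sum]
        refine Finset.sum_congr rfl fun τ _ => ?_
        rw [pairProd_succ, Fin.prod_univ_castSucc]
        simp only [permOfLast_last, permOfLast_castSucc, hlast, ← hy, Fin.rev_castSucc,
          Fin.val_succ, Fin.val_castSucc, Fin.val_last, Fin.rev_last, Fin.val_zero, pow_zero,
          pow_succ, mul_one, Finset.prod_mul_distrib]
        rw [← Equiv.prod_comp τ (fun j => w.vacX (u (i.succAbove j))),
          ← Equiv.prod_comp τ (fun j => w.direct (u i) (u (i.succAbove j)))]
        ring
    · push Not at h
      choose y hy using fun k => Fin.exists_castSucc_eq.2 (h k)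
      obtain rfl : (fun j => (y j).castSucc) = x := funext hy
      have hymono : StrictMono y := fun a b hab => Fin.castSucc_lt_castSucc_iff.1 (hx hab)
      rw [markedConf_castSucc, betheVec_vacant, ih u hu y hymono, Finset.mul_sum]
      refine Finset.sum_congr rfl fun σ _ => ?_
      rw [← Equiv.prod_comp σ (fun j => w.vacX (u j))]
      simp only [Fin.rev_castSucc, Fin.val_succ, Fin.val_castSucc, pow_succ,
        Finset.prod_mul_distrib]
      ring

/-- If `Q j k` is the ratio of `P k j` to `P j k` for `j < k`, then multiplying by `Q` over the
inversions of `σ` permutes the indices in the product of `P` over pairs. -/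
theorem pairProd_mul_invProd {N : ℕ} (σ : Equiv.Perm (Fin N)) (P Q : Fin N → Fin N → ℂ)
    (h : ∀ j k, j < k → P j k * Q j k = P k j) :
    pairProd P * invProd σ (fun j k => Q (σ k) (σ j)) = pairProd (fun j k => P (σ j) (σ k)) := by
  have hinv : invProd σ (fun j k => Q (σ k) (σ j)) =
      pairProd (fun j k => if σ k < σ j then Q (σ k) (σ j) else 1) := by
    rw [pairProd, invProd, ← Finset.prod_filter, Finset.filter_filter]
  -- Both sides run over the unordered pairs of indices, once for each.
  have hP : pairProd P =
      pairProd (fun j k => if σ k < σ j then P (σ k) (σ j) else P (σ j) (σ k)) := by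
    symm
    refine Finset.prod_bij' (fun q _ => if σ q.2 < σ q.1 then (σ q.2, σ q.1) else (σ q.1, σ q.2))
      (fun q _ => if σ.symm q.2 < σ.symm q.1 then (σ.symm q.2, σ.symm q.1)
        else (σ.symm q.1, σ.symm q.2)) ?_ ?_ ?_ ?_ ?_
    · rintro ⟨j, k⟩ hq
      have hjk : j < k := by simpa using hq
      have := σ.injective.ne hjk.ne
      by_cases hs : σ k < σ j
      · simp [hs]
      · simpa [hs] using lt_of_le_of_ne (not_lt.1 hs) this
    · rintro ⟨j, k⟩ hq
      have hjk : j < k := by simpa using hq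
      have := σ.symm.injective.ne hjk.ne
      by_cases hs : σ.symm k < σ.symm j
      · simp [hs]
      · simpa [hs] using lt_of_le_of_ne (not_lt.1 hs) this
    · rintro ⟨j, k⟩ hq
      have hjk : j < k := by simpa using hq
      by_cases hs : σ k < σ j <;> simp [hs, hjk, hjk.not_gt]
    · rintro ⟨j, k⟩ hq
      have hjk : j < k := by simpa using hq
      by_cases hs : σ.symm k < σ.symm j <;> simp [hs, hjk, hjk.not_gt]
    · rintro ⟨j, k⟩ _
      by_cases hs : σ k < σ j <;> simp [hs]
  rw [hinv, hP, pairProd, pairProd, pairProd, ← Finset.prod_mul_distrib]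
  refine Finset.prod_congr rfl fun q _ => ?_
  by_cases hs : σ q.2 < σ q.1
  · simpa [hs] using h _ _ hs
  · simp [hs]

/-- The coordinates of a Bethe vector with the term of the identity permutation factored out; the
ratio `Q` compares the two orders in which a pair of parameters can occur. -/
theorem betheVec_eq {w : SiteWeights ι} (hw : w.Exchange) (o : Fin 2) (M : ℕ) {N : ℕ}
    (u : Fin N → ι) (hu : Function.Injective u) (x : Fin N → Fin M) (hx : StrictMono x)
    (hX : ∀ j, w.vacX (u j) ≠ 0) (hY : ∀ j, w.vacY (u j) ≠ 0) (Q : Fin N → Fin N → ℂ)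
    (hQ : ∀ j k, j < k → w.direct (u k) (u j) * Q j k = w.direct (u j) (u k)) :
    betheVec w o M u (markedConf o x) =
      (∏ j, w.create (u j) * w.vacX (u j) ^ M / w.vacY (u j)) *
        pairProd (fun j k => w.direct (u k) (u j)) *
        ∑ σ : Equiv.Perm (Fin N), invProd σ (fun j k => Q (σ k) (σ j)) *
          ∏ j, (w.vacY (u (σ j)) / w.vacX (u (σ j))) ^ ((x j : ℕ) + 1) := by
  rw [betheVec_markedConf hw o M u hu x hx, Finset.mul_sum]
  refine Finset.sum_congr rfl fun σ _ => ?_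
  rw [← pairProd_mul_invProd σ (fun j k => w.direct (u k) (u j)) Q hQ,
    ← Equiv.prod_comp σ (fun j => w.create (u j) * w.vacX (u j) ^ M / w.vacY (u j))]
  have hj : ∏ j, w.create (u (σ j)) * w.vacY (u (σ j)) ^ (x j : ℕ) *
      w.vacX (u (σ j)) ^ ((x j).rev : ℕ) =
      (∏ j, w.create (u (σ j)) * w.vacX (u (σ j)) ^ M / w.vacY (u (σ j))) *
        ∏ j, (w.vacY (u (σ j)) / w.vacX (u (σ j))) ^ ((x j : ℕ) + 1) := by
    rw [← Finset.prod_mul_distrib]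
    refine Finset.prod_congr rfl fun j _ => ?_
    have h1 := hX (σ j)
    have h2 := hY (σ j)
    have hM : w.vacX (u (σ j)) ^ M =
        w.vacX (u (σ j)) ^ ((x j).rev : ℕ) * w.vacX (u (σ j)) ^ ((x j : ℕ) + 1) := by
      rw [← pow_add]; congr 1; rw [Fin.val_rev]; omega
    rw [hM, div_pow, pow_succ (w.vacY _)]
    field_simp
  rw [hj]
  ring

/-! ### The weights of the four families of operators -/

/-- Weights for `X = B`, `Y = D` on the vacuum `|0⋯0⟩`. -/
noncomputable def weightsB (p : Params) : SiteWeights ℂ where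
  vacX u := p.a * u + p.b
  excX u := p.a * p.t * u + p.b
  create u := (1 - p.t) * p.c * u
  vacY u := p.e * u + p.f
  excY u := p.e * u + p.t * p.f
  annihilate _ := (1 - p.t) * p.d
  direct u v := (p.t * v - u) / (v - u)
  cross u v := (1 - p.t) * v / (v - u)

/-- Weights for `X = Cᵀ`, `Y = Aᵀ` on the vacuum `|0⋯0⟩`. -/
noncomputable def weightsC (p : Params) : SiteWeights ℂ where
  vacX u := p.e * u + p.f
  excX u := p.e * u + p.t * p.f
  create _ := (1 - p.t) * p.d
  vacY u := p.a * u + p.b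
  excY u := p.a * p.t * u + p.b
  annihilate u := (1 - p.t) * p.c * u
  direct u v := (v - p.t * u) / (v - u)
  cross u v := (p.t - 1) * u / (v - u)

/-- Weights for `X = Bᵀ`, `Y = Dᵀ` on the vacuum `|1⋯1⟩`. Transposition turns the relation of
`weightsB` into one for `Bᵀ(v)Dᵀ(u)`. Solving it, together with its copy for `u` and `v` exchanged,
for `Dᵀ(u)Bᵀ(v)` is where the division by `t` comes from. -/
noncomputable def weightsBHole (p : Params) : SiteWeights ℂ where
  vacX u := p.a * p.t * u + p.b
  excX u := p.a * u + p.b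
  create u := (1 - p.t) * p.c * u
  vacY u := p.e * u + p.t * p.f
  excY u := p.e * u + p.f
  annihilate _ := (1 - p.t) * p.d
  direct u v := (v - p.t * u) / (p.t * (v - u))
  cross u v := (p.t - 1) * v / (p.t * (v - u))

/-- Weights for `X = C`, `Y = A` on the vacuum `|1⋯1⟩`. They divide by `t` for the same reason as
`weightsBHole`, with `weightsC` in place of `weightsB`. -/
noncomputable def weightsCHole (p : Params) : SiteWeights ℂ where
  vacX u := p.e * u + p.t * p.f
  excX u := p.e * u + p.f
  create _ := (1 - p.t) * p.d
  vacY u := p.a * p.t * u + p.b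
  excY u := p.a * u + p.b
  annihilate u := (1 - p.t) * p.c * u
  direct u v := (p.t * v - u) / (p.t * (v - u))
  cross u v := (1 - p.t) * u / (p.t * (v - u))

theorem weightsB_exchange {p : Params} (hp : p.Constraints) :
    (weightsB p).Exchange := by
  obtain ⟨h1, h2⟩ := hp
  constructor <;> intro u v h <;> simp only [weightsB] <;> have h0 := sub_ne_zero.2 h
  case vac_vac =>
    rw [← neg_sub u v]
    field_simp
    linear_combination (1 - p.t) * v * (u - v) * (h1 - h2)
  case exc_exc' =>
    rw [← neg_sub u v]
    field_simp
    linear_combination (1 - p.t) * v * (u - v) ^ 2 * (p.t ^ 2 * h1 - h2)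
  case cross_cross =>
    intro w h' h''
    have := sub_ne_zero.2 h'
    have := sub_ne_zero.2 h''
    rw [← neg_sub u v, ← neg_sub u w, ← neg_sub v w]
    field_simp
    ring
  all_goals
    rw [← neg_sub u v]
    field_simp
    ring

theorem weightsC_exchange {p : Params} (hp : p.Constraints) :
    (weightsC p).Exchange := by
  obtain ⟨h1, h2⟩ := hp
  constructor <;> intro u v h <;> simp only [weightsC] <;> have h0 := sub_ne_zero.2 h
  case vac_vac =>
    rw [← neg_sub u v]
    field_simp
    linear_combination (1 - p.t) * u * (u - v) * (h1 - h2)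
  case exc_exc' =>
    rw [← neg_sub u v]
    field_simp
    linear_combination (1 - p.t) * u * (u - v) ^ 2 * (p.t ^ 2 * h1 - h2)
  case cross_cross =>
    intro w h' h''
    have := sub_ne_zero.2 h'
    have := sub_ne_zero.2 h''
    rw [← neg_sub u v, ← neg_sub u w, ← neg_sub v w]
    field_simp
    ring
  all_goals
    rw [← neg_sub u v]
    field_simp
    ring

theorem weightsBHole_exchange {p : Params} (hp : p.Constraints) (ht : p.t ≠ 0) :
    (weightsBHole p).Exchange := by
  obtain ⟨h1, h2⟩ := hp
  constructor <;> intro u v h <;> simp only [weightsBHole] <;> have h0 := sub_ne_zero.2 h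
  case vac_vac =>
    rw [← neg_sub u v]
    field_simp
    linear_combination (p.t - 1) * v * (u - v) * (p.t ^ 2 * h1 - h2)
  case exc_exc' =>
    rw [← neg_sub u v]
    field_simp
    linear_combination p.t * (p.t - 1) * v * (u - v) ^ 2 * (h1 - h2)
  case cross_cross =>
    intro w h' h''
    have := sub_ne_zero.2 h'
    have := sub_ne_zero.2 h''
    rw [← neg_sub u v, ← neg_sub u w, ← neg_sub v w]
    field_simp
    ring
  all_goals
    rw [← neg_sub u v]
    field_simp
    ring

theorem weightsCHole_exchange {p : Params} (hp : p.Constraints) (ht : p.t ≠ 0) :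
    (weightsCHole p).Exchange := by
  obtain ⟨h1, h2⟩ := hp
  constructor <;> intro u v h <;> simp only [weightsCHole] <;> have h0 := sub_ne_zero.2 h
  case vac_vac =>
    rw [← neg_sub u v]
    field_simp
    linear_combination (p.t - 1) * u * (u - v) * (p.t ^ 2 * h1 - h2)
  case exc_exc' =>
    rw [← neg_sub u v]
    field_simp
    linear_combination p.t * (p.t - 1) * u * (u - v) ^ 2 * (h1 - h2)
  case cross_cross =>
    intro w h' h''
    have := sub_ne_zero.2 h'
    have := sub_ne_zero.2 h''
    rw [← neg_sub u v, ← neg_sub u w, ← neg_sub v w]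
    field_simp
    ring
  all_goals
    rw [← neg_sub u v]
    field_simp
    ring

/-! ### Monodromy matrix and basis vectors -/

theorem lOpAt_last_snoc (p : Params) (M : ℕ) (u : ℂ) (α β : Fin 2) (r s : Conf M) (x y : Fin 2) :
    lOpAt p (M + 1) u (Fin.last M) (α, Fin.snoc (α := fun _ => Fin 2) r x)
      (β, Fin.snoc (α := fun _ => Fin 2) s y) = if r = s then lOp p u (α, x) (β, y) else 0 := by
  have : (∀ k, k ≠ Fin.last M → (Fin.snoc (α := fun _ => Fin 2) r x : Conf (M + 1)) k =
      (Fin.snoc (α := fun _ => Fin 2) s y : Conf (M + 1)) k) ↔ r = s := by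
    simp [Fin.forall_fin_succ', Fin.castSucc_ne_last, funext_iff]
  simp only [lOpAt, of_apply, this, Fin.snoc_last]

theorem lOpAt_castSucc_snoc (p : Params) (M : ℕ) (u : ℂ) (j : Fin M) (α β : Fin 2) (r s : Conf M)
    (x y : Fin 2) :
    lOpAt p (M + 1) u j.castSucc (α, Fin.snoc (α := fun _ => Fin 2) r x)
      (β, Fin.snoc (α := fun _ => Fin 2) s y) =
        if x = y then lOpAt p M u j (α, r) (β, s) else 0 := by
  have : (∀ k, k ≠ j.castSucc → (Fin.snoc (α := fun _ => Fin 2) r x : Conf (M + 1)) k =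
      (Fin.snoc (α := fun _ => Fin 2) s y : Conf (M + 1)) k) ↔ x = y ∧ ∀ k, k ≠ j → r k = s k := by
    simp [Fin.forall_fin_succ', (Fin.castSucc_ne_last _).symm, and_comm]
  simp only [lOpAt, of_apply, this, Fin.snoc_castSucc, ite_and]

theorem sum_snoc {M : ℕ} (F : Conf (M + 1) → ℂ) :
    ∑ s, F s = ∑ x : Fin 2, ∑ s : Conf M, F (Fin.snoc (α := fun _ => Fin 2) s x) := by
  rw [← Equiv.sum_comp (Fin.snocEquiv fun _ => Fin 2), Fintype.sum_prod_type]
  rfl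

theorem prod_lOpAt_castSucc_snoc (p : Params) (M : ℕ) (u : ℂ) (l : List (Fin M)) (α β : Fin 2)
    (r s : Conf M) (x y : Fin 2) :
    (l.map fun j => lOpAt p (M + 1) u j.castSucc).prod (α, Fin.snoc (α := fun _ => Fin 2) r x)
      (β, Fin.snoc (α := fun _ => Fin 2) s y) =
        if x = y then (l.map fun j => lOpAt p M u j).prod (α, r) (β, s) else 0 := by
  induction l generalizing α r x with
  | nil =>
    simp [one_apply, Fin.snoc_inj, ← and_assoc, ite_and]
    by_cases h : x = y <;> simp [h]
  | cons j l ih =>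
    simp only [List.map_cons, List.prod_cons, mul_apply, Fintype.sum_prod_type, sum_snoc,
      lOpAt_castSucc_snoc, ih]
    by_cases h : x = y <;> simp [h]

/-- The monodromy matrix of `M + 1` sites is the product of the last `L`-operator with the
monodromy matrix of `M` sites. -/
theorem monodromy_succ_snoc (p : Params) (M : ℕ) (u : ℂ) (α β : Fin 2) (r s : Conf M)
    (x y : Fin 2) :
    monodromy p (M + 1) u (α, Fin.snoc (α := fun _ => Fin 2) r x)
      (β, Fin.snoc (α := fun _ => Fin 2) s y) =
        ∑ γ, lOp p u (α, x) (γ, y) * monodromy p M u (γ, r) (β, s) := by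
  have hl : ∀ K, ∀ F : Fin M → Matrix (Fin 2 × Conf K) (Fin 2 × Conf K) ℂ,
      (List.ofFn F).reverse = ((List.finRange M).reverse).map F := fun K F => by
    rw [List.ofFn_eq_map, List.map_reverse]
  rw [monodromy, monodromy, List.ofFn_succ_last, List.reverse_append, List.reverse_singleton,
    List.singleton_append, List.prod_cons, hl, hl]
  simp only [mul_apply, Fintype.sum_prod_type, sum_snoc, lOpAt_last_snoc, prod_lOpAt_castSucc_snoc]
  simp

/-- The entry `⟨α|T_a(u)|β⟩` of the monodromy matrix in the auxiliary space. -/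
noncomputable def monodromyEntry (p : Params) (α β : Fin 2) (M : ℕ) (u : ℂ) :
    Matrix (Conf M) (Conf M) ℂ :=
  Matrix.of fun r s => monodromy p M u (α, r) (β, s)

theorem monodromyEntry_zero (p : Params) (α β : Fin 2) (u : ℂ) :
    monodromyEntry p α β 0 u = if α = β then 1 else 0 := by
  ext r s
  obtain rfl := Subsingleton.elim r s
  by_cases h : α = β <;> simp [monodromyEntry, monodromy, one_apply, h]

theorem lOp_apply (p : Params) (u : ℂ) (α x β y : Fin 2) :
    lOp p u (α, x) (β, y) =
      (![![![![p.a * u + p.b, 0], ![0, 0]],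
          ![![0, p.a * p.t * u + p.b], ![(1 - p.t) * p.c * u, 0]]],
        ![![![0, (1 - p.t) * p.d], ![p.e * u + p.f, 0]],
          ![![0, 0], ![0, p.e * u + p.t * p.f]]]] :
          Fin 2 → Fin 2 → Fin 2 → Fin 2 → ℂ) α x β y := by
  fin_cases α <;> fin_cases x <;> fin_cases β <;> fin_cases y <;> rfl

/-- The operators of the abstract chain are determined by their values on the empty chain and by
their blocks with respect to the last site. -/
theorem chainOps_eq {ι : Type*} (w : SiteWeights ι) (o : Fin 2)
    (X Y : (M : ℕ) → ι → Matrix (Conf M) (Conf M) ℂ)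
    (h0 : ∀ i, X 0 i = 0 ∧ Y 0 i = 1)
    (hs : ∀ M i, (X (M + 1) i).submatrix (splitLast o M) (splitLast o M) =
        fromBlocks (w.vacX i • X M i) 0 (w.create i • Y M i) (w.excX i • X M i) ∧
      (Y (M + 1) i).submatrix (splitLast o M) (splitLast o M) =
        fromBlocks (w.vacY i • Y M i) (w.annihilate i • X M i) 0 (w.excY i • Y M i))
    (M : ℕ) (i : ι) : chainX w o M i = X M i ∧ chainY w o M i = Y M i := by
  induction M with
  | zero => exact ⟨(h0 i).1.symm, (h0 i).2.symm⟩
  | succ M ih =>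
    rw [chainX_succ, chainY_succ, ih.1, ih.2, ← (hs M i).1, ← (hs M i).2]
    simp [coe_reindexAlgEquiv]

theorem chainX_weightsB (p : Params) (M : ℕ) (u : ℂ) : chainX (weightsB p) 0 M u = opB p M u := by
  refine (chainOps_eq (weightsB p) 0 (fun M u => monodromyEntry p 0 1 M u)
    (fun M u => monodromyEntry p 1 1 M u) (fun u => ?_) (fun M u => ⟨?_, ?_⟩) M u).1
  · simp [monodromyEntry_zero]
  · ext (r | r) (s | s) <;>
      simp [monodromyEntry, monodromy_succ_snoc, splitLast, lOp_apply, weightsB]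
  · ext (r | r) (s | s) <;>
      simp [monodromyEntry, monodromy_succ_snoc, splitLast, lOp_apply, weightsB]

theorem chainX_weightsC (p : Params) (M : ℕ) (u : ℂ) :
    chainX (weightsC p) 0 M u = (opC p M u)ᵀ := by
  refine (chainOps_eq (weightsC p) 0 (fun M u => (monodromyEntry p 1 0 M u)ᵀ)
    (fun M u => (monodromyEntry p 0 0 M u)ᵀ) (fun u => ?_) (fun M u => ⟨?_, ?_⟩) M u).1
  · simp [monodromyEntry_zero]
  · ext (r | r) (s | s) <;>
      simp [monodromyEntry, monodromy_succ_snoc, splitLast, lOp_apply, weightsC]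
  · ext (r | r) (s | s) <;>
      simp [monodromyEntry, monodromy_succ_snoc, splitLast, lOp_apply, weightsC]

theorem chainX_weightsBHole (p : Params) (M : ℕ) (u : ℂ) :
    chainX (weightsBHole p) 1 M u = (opB p M u)ᵀ := by
  refine (chainOps_eq (weightsBHole p) 1 (fun M u => (monodromyEntry p 0 1 M u)ᵀ)
    (fun M u => (monodromyEntry p 1 1 M u)ᵀ) (fun u => ?_) (fun M u => ⟨?_, ?_⟩) M u).1
  · simp [monodromyEntry_zero]
  · ext (r | r) (s | s) <;>
      simp [monodromyEntry, monodromy_succ_snoc, splitLast, lOp_apply, weightsBHole]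
  · ext (r | r) (s | s) <;>
      simp [monodromyEntry, monodromy_succ_snoc, splitLast, lOp_apply, weightsBHole]

theorem chainX_weightsCHole (p : Params) (M : ℕ) (u : ℂ) :
    chainX (weightsCHole p) 1 M u = opC p M u := by
  refine (chainOps_eq (weightsCHole p) 1 (fun M u => monodromyEntry p 1 0 M u)
    (fun M u => monodromyEntry p 0 0 M u) (fun u => ?_) (fun M u => ⟨?_, ?_⟩) M u).1
  · simp [monodromyEntry_zero]
  · ext (r | r) (s | s) <;>
      simp [monodromyEntry, monodromy_succ_snoc, splitLast, lOp_apply, weightsCHole]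
  · ext (r | r) (s | s) <;>
      simp [monodromyEntry, monodromy_succ_snoc, splitLast, lOp_apply, weightsCHole]

theorem siteProd_succ_last {M N : ℕ} (A : Matrix (Fin 2) (Fin 2) ℂ) (x : Fin (N + 1) → Fin M) :
    siteProd A x = siteProd A (fun j => x j.castSucc) * siteOp A (x (Fin.last N)) := by
  simp only [siteProd, List.ofFn_succ_last, List.prod_append, List.prod_singleton]

theorem siteProd_succ {M N : ℕ} (A : Matrix (Fin 2) (Fin 2) ℂ) (x : Fin (N + 1) → Fin M) :
    siteProd A x = siteOp A (x 0) * siteProd A (fun j => x j.succ) := by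
  simp [siteProd, List.ofFn_succ]

theorem single_vecMul_siteOp {M : ℕ} (A : Matrix (Fin 2) (Fin 2) ℂ) (j : Fin M) (s : Conf M)
    (η : Fin 2) (hA : ∀ ε, A (s j) ε = if ε = η then 1 else 0) :
    Pi.single s 1 ᵥ* siteOp A j = Pi.single (Function.update s j η) 1 := by
  ext r
  simp only [single_vecMul, siteOp, of_apply, hA, Pi.single_apply, Function.eq_update_iff,
    ← ite_and, one_smul, row_apply]
  refine if_congr ⟨fun h => ⟨h.2, fun k hk => (h.1 k hk).symm⟩,
    fun h => ⟨fun k hk => (h.2 k hk).symm, h.1⟩⟩ rfl rfl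

theorem siteOp_mulVec_single {M : ℕ} (A : Matrix (Fin 2) (Fin 2) ℂ) (j : Fin M) (s : Conf M)
    (η : Fin 2) (hA : ∀ ε, A ε (s j) = if ε = η then 1 else 0) :
    siteOp A j *ᵥ Pi.single s 1 = Pi.single (Function.update s j η) 1 := by
  ext r
  simp only [mulVec_single_one, siteOp, of_apply, hA, Pi.single_apply,
    Function.eq_update_iff, ← ite_and, col_apply]
  refine if_congr ⟨fun h => ⟨h.2, h.1⟩, fun h => ⟨h.2, h.1⟩⟩ rfl rfl

theorem uniformVec_vecMul_siteProd {M N : ℕ} (A : Matrix (Fin 2) (Fin 2) ℂ) (o : Fin 2)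
    (hA : ∀ ε, A o ε = if ε = 1 - o then 1 else 0) (x : Fin N → Fin M)
    (hx : Function.Injective x) :
    uniformVec o M ᵥ* siteProd A x = Pi.single (markedConf o x) 1 := by
  induction N with
  | zero =>
    have h : markedConf o x = fun _ => o := by ext; simp [markedConf]
    simp [siteProd, uniformVec, h]
  | succ N ih =>
    have h : markedConf o (fun j => x j.castSucc) (x (Fin.last N)) = o :=
      if_neg fun ⟨j, hj⟩ => (Fin.castSucc_lt_last j).ne (hx hj)
    rw [siteProd_succ_last, ← vecMul_vecMul, ih _ (fun a b h => Fin.castSucc_injective _ (hx h)),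
      single_vecMul_siteOp _ _ _ (1 - o) (by rwa [h])]
    congr 1
    ext k
    simp only [markedConf, Function.update_apply, Fin.exists_fin_succ', eq_comm (a := k)]
    split_ifs <;> simp_all

theorem siteProd_mulVec_uniformVec {M N : ℕ} (A : Matrix (Fin 2) (Fin 2) ℂ) (o : Fin 2)
    (hA : ∀ ε, A ε o = if ε = 1 - o then 1 else 0) (x : Fin N → Fin M)
    (hx : Function.Injective x) :
    siteProd A x *ᵥ uniformVec o M = Pi.single (markedConf o x) 1 := by
  induction N with
  | zero =>
    have h : markedConf o x = fun _ => o := by ext; simp [markedConf]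
    rw [siteProd, List.ofFn_zero, List.prod_nil, one_mulVec, uniformVec, h]
  | succ N ih =>
    have h : markedConf o (fun j => x j.succ) (x 0) = o :=
      if_neg fun ⟨j, hj⟩ => (Fin.succ_ne_zero j) (hx hj)
    rw [siteProd_succ, ← mulVec_mulVec, ih _ (fun a b h => Fin.succ_injective _ (hx h)),
      siteOp_mulVec_single _ _ _ (1 - o) (by rwa [h])]
    congr 1
    ext k
    simp only [markedConf, Function.update_apply, Fin.exists_fin_succ, eq_comm (a := k)]
    split_ifs <;> simp_all

/-- Transposition turns the bra `⟨o⋯o| X(u_1) ⋯ X(u_N)` into the Bethe vector of the transposed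
operators. -/
theorem vecMul_prod_eq_betheVec {ι : Type*} (w : SiteWeights ι) (o : Fin 2) (M : ℕ) {N : ℕ}
    (u : Fin N → ι) (X : ι → Matrix (Conf M) (Conf M) ℂ) (h : ∀ i, chainX w o M i = (X i)ᵀ) :
    uniformVec o M ᵥ* (List.ofFn fun j => X (u j)).prod = betheVec w o M u := by
  rw [betheVec, ← mulVec_transpose, transpose_list_prod, List.map_ofFn]
  simp [h, uniformVec, Function.comp_def]

/-! ### The four amplitudes -/

/-- The hypotheses of the hole formulas exclude `t = 0`: there the constraint `tcd + be = 0` becomes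
`be = 0`, while the two factors reduce to `b` and `eu`. -/
theorem t_ne_zero_of_hole {p : Params} (hp : p.Constraints) {u : ℂ} (hX : p.a * p.t * u + p.b ≠ 0)
    (hY : p.e * u + p.t * p.f ≠ 0) : p.t ≠ 0 := by
  intro ht
  have h := hp.2
  simp only [ht, zero_mul, mul_zero, zero_add, add_zero] at h hX hY
  exact (mul_ne_zero hX (left_ne_zero_of_mul hY)) h

theorem particleBra_dotProduct_psiKet {p : Params} (hp : p.Constraints) {M N : ℕ}
    {x : Fin N → Fin M} (hx : StrictMono x) {u : Fin N → ℂ} (hu : Function.Injective u)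
    (hX : ∀ j, p.a * u j + p.b ≠ 0) (hY : ∀ j, p.e * u j + p.f ≠ 0)
    (hden : ∀ j k, j < k → p.t * u j - u k ≠ 0) :
    particleBra x ⬝ᵥ psiKet p M u = polyG p M x u := by
  have hne : ∀ j k, j < k → u j - u k ≠ 0 := fun j k h => sub_ne_zero.2 (hu.ne h.ne)
  have hket : psiKet p M u = betheVec (weightsB p) 0 M u := by
    simp only [betheVec, chainX_weightsB]; rfl
  have hbra : particleBra x = Pi.single (markedConf 0 x) 1 :=
    uniformVec_vecMul_siteProd sigmaPlus 0
      (by simp [sigmaPlus, Fin.forall_fin_two]) x hx.injective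
  rw [hbra, hket, single_one_dotProduct,
    betheVec_eq (weightsB_exchange hp) 0 M u hu x hx hX hY
      (fun j k => (u j - p.t * u k) / (p.t * u j - u k))]
  · rfl
  · intro j k h
    have h1 := hne j k h
    have h2 := hden j k h
    simp only [weightsB]
    rw [← neg_sub (u j) (u k)]
    field_simp
    ring

theorem psiBra_dotProduct_particleKet {p : Params} (hp : p.Constraints) {M N : ℕ}
    {x : Fin N → Fin M} (hx : StrictMono x) {u : Fin N → ℂ} (hu : Function.Injective u)
    (hX : ∀ j, p.a * u j + p.b ≠ 0) (hY : ∀ j, p.e * u j + p.f ≠ 0)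
    (hden : ∀ j k, j < k → u j - p.t * u k ≠ 0) :
    psiBra p M u ⬝ᵥ particleKet x = polyGBar p M x u := by
  have hne : ∀ j k, j < k → u j - u k ≠ 0 := fun j k h => sub_ne_zero.2 (hu.ne h.ne)
  have hbra : psiBra p M u = betheVec (weightsC p) 0 M u :=
    vecMul_prod_eq_betheVec (weightsC p) 0 M u (opC p M) (chainX_weightsC p M)
  have hket : particleKet x = Pi.single (markedConf 0 x) 1 :=
    siteProd_mulVec_uniformVec sigmaMinus 0
      (by simp [sigmaMinus, Fin.forall_fin_two]) x hx.injective
  rw [hbra, hket, dotProduct_single_one,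
    betheVec_eq (weightsC_exchange hp) 0 M u hu x hx hY hX
      (fun j k => (p.t * u j - u k) / (u j - p.t * u k))]
  · rfl
  · intro j k h
    have h1 := hne j k h
    have h2 := hden j k h
    simp only [weightsC]
    rw [← neg_sub (u j) (u k)]
    field_simp
    ring

theorem phiBra_dotProduct_holeKet {p : Params} (hp : p.Constraints) {M N : ℕ}
    {x : Fin N → Fin M} (hx : StrictMono x) {u : Fin N → ℂ} (hu : Function.Injective u)
    (hX : ∀ j, p.a * p.t * u j + p.b ≠ 0) (hY : ∀ j, p.e * u j + p.t * p.f ≠ 0)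
    (hden : ∀ j k, j < k → u j - p.t * u k ≠ 0) :
    phiBra p M u ⬝ᵥ holeKet x = polyH p M x u := by
  have hne : ∀ j k, j < k → u j - u k ≠ 0 := fun j k h => sub_ne_zero.2 (hu.ne h.ne)
  -- For `N = 0` the parameter `t` may vanish, and both sides equal `1`.
  obtain rfl | hN := N.eq_zero_or_pos
  · simp [phiBra, holeKet, polyH, siteProd, occupied, pairProd, invProd]
  have ht : p.t ≠ 0 := t_ne_zero_of_hole hp (hX ⟨0, hN⟩) (hY ⟨0, hN⟩)
  have hbra : phiBra p M u = betheVec (weightsBHole p) 1 M u :=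
    vecMul_prod_eq_betheVec (weightsBHole p) 1 M u (opB p M) (chainX_weightsBHole p M)
  have hket : holeKet x = Pi.single (markedConf 1 x) 1 :=
    siteProd_mulVec_uniformVec sigmaPlus 1
      (by simp [sigmaPlus, Fin.forall_fin_two]) x hx.injective
  rw [hbra, hket, dotProduct_single_one,
    betheVec_eq (weightsBHole_exchange hp ht) 1 M u hu x hx hX hY
      (fun j k => (p.t * u j - u k) / (u j - p.t * u k))]
  · rfl
  · intro j k h
    have h1 := hne j k h
    have h2 := hden j k h
    simp only [weightsBHole]
    rw [← neg_sub (u j) (u k)]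
    field_simp
    ring

theorem holeBra_dotProduct_phiKet {p : Params} (hp : p.Constraints) {M N : ℕ}
    {x : Fin N → Fin M} (hx : StrictMono x) {u : Fin N → ℂ} (hu : Function.Injective u)
    (hX : ∀ j, p.a * p.t * u j + p.b ≠ 0) (hY : ∀ j, p.e * u j + p.t * p.f ≠ 0)
    (hden : ∀ j k, j < k → p.t * u j - u k ≠ 0) :
    holeBra x ⬝ᵥ phiKet p M u = polyHBar p M x u := by
  have hne : ∀ j k, j < k → u j - u k ≠ 0 := fun j k h => sub_ne_zero.2 (hu.ne h.ne)
  -- For `N = 0` the parameter `t` may vanish, and both sides equal `1`.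
  obtain rfl | hN := N.eq_zero_or_pos
  · simp [holeBra, phiKet, polyHBar, siteProd, occupied, pairProd, invProd]
  have ht : p.t ≠ 0 := t_ne_zero_of_hole hp (hX ⟨0, hN⟩) (hY ⟨0, hN⟩)
  have hket : phiKet p M u = betheVec (weightsCHole p) 1 M u := by
    simp only [betheVec, chainX_weightsCHole]; rfl
  have hbra : holeBra x = Pi.single (markedConf 1 x) 1 :=
    uniformVec_vecMul_siteProd sigmaMinus 1
      (by simp [sigmaMinus, Fin.forall_fin_two]) x hx.injective
  rw [hbra, hket, single_one_dotProduct,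
    betheVec_eq (weightsCHole_exchange hp ht) 1 M u hu x hx hY hX
      (fun j k => (u j - p.t * u k) / (p.t * u j - u k))]
  · rfl
  · intro j k h
    have h1 := hne j k h
    have h2 := hden j k h
    simp only [weightsCHole]
    rw [← neg_sub (u j) (u k)]
    field_simp
    ring

end SixVertex

theorem mainTheorem1 (p : SixVertex.Params) (hp : p.Constraints) (M N : ℕ)
    (x : Fin N → Fin M) (hx : StrictMono x) (u : Fin N → ℂ) (hu : Function.Injective u) :
    ((∀ j, p.a * u j + p.b ≠ 0) → (∀ j, p.e * u j + p.f ≠ 0) →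
        (∀ j k, j < k → p.t * u j - u k ≠ 0) →
        SixVertex.particleBra x ⬝ᵥ SixVertex.psiKet p M u = SixVertex.polyG p M x u) ∧
    ((∀ j, p.a * u j + p.b ≠ 0) → (∀ j, p.e * u j + p.f ≠ 0) →
        (∀ j k, j < k → u j - p.t * u k ≠ 0) →
        SixVertex.psiBra p M u ⬝ᵥ SixVertex.particleKet x = SixVertex.polyGBar p M x u) ∧
    ((∀ j, p.a * p.t * u j + p.b ≠ 0) → (∀ j, p.e * u j + p.t * p.f ≠ 0) →
        (∀ j k, j < k → u j - p.t * u k ≠ 0) →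
        SixVertex.phiBra p M u ⬝ᵥ SixVertex.holeKet x = SixVertex.polyH p M x u) ∧
    ((∀ j, p.a * p.t * u j + p.b ≠ 0) → (∀ j, p.e * u j + p.t * p.f ≠ 0) →
        (∀ j k, j < k → p.t * u j - u k ≠ 0) →
        SixVertex.holeBra x ⬝ᵥ SixVertex.phiKet p M u = SixVertex.polyHBar p M x u) :=
  ⟨fun hX hY hden => SixVertex.particleBra_dotProduct_psiKet hp hx hu hX hY hden,
    fun hX hY hden => SixVertex.psiBra_dotProduct_particleKet hp hx hu hX hY hden,
    fun hX hY hden => SixVertex.phiBra_dotProduct_holeKet hp hx hu hX hY hden,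
    fun hX hY hden => SixVertex.holeBra_dotProduct_phiKet hp hx hu hX hY hden⟩
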